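/- Let $\mathcal X$ be a measurable input space (for example a Borel set $\mathcal X\subseteq\mathbb R^d$), let labels be binary, let $\mathcal H$ be a set of functions $h:\mathcal X\to\{\pm1\}$, and let $\mathcal B(x)\subseteq\mathcal X$ be a nonempty set of perturbations for each $x\in\mathcal X$. Let $\mathcal D_S,\mathcal D_T$ be probability distributions of labeled examples $(x,y)$. Write $$L^{0/1}_{\rm adv}(h;\mathcal D_T)=\mathbb E_{(x,y)\sim\mathcal D_T}\,\ell_h(x,y),\qquad \ell_h(x,y)=\sup_{\tilde x\in\mathcal B(x)}\mathbf 1[h(\tilde x)\ne y],$$ and, for a labeled sample $\mathcal Z=((x_i,y_i))_{i=1}^n$, $L^{0/1}(h;\mathcal Z)=\frac1n\sum_{i=1}^n\mathbf 1[h(x_i)\neq y_i]$. Let $\mathrm{VC}(\mathcal H)$ be the VC dimension of $\mathcal H$ and let the adversarial VC dimension $\mathrm{AVC}(\mathcal H)$ be the VC dimension of the class $\{\ell_h:h\in\mathcal H\}$ of functions on labeled examples. Let $\mathcal H\Delta\mathcal H$ be the set of functions $x\mapsto h_1(x)\oplus h_2(x)$, $h_1,h_2\in\mathcal H$, with value $1$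 where $h_1(x)\ne h_2(x)$ and $0$ elsewhere. For $\mathrm X_S=(x_i^s)_{i=1}^n$, $\mathrm X_T=(x_i^t)_{i=1}^n$ and labeled samples $\mathcal Z_S,\mathcal Z_T$ of size $n$ put $$d_{\mathcal H\Delta\mathcal H}(\mathrm X_S,\mathrm X_T)=2\sup_{g\in\mathcal H\Delta\mathcal H}\Big|\frac1n\sum_{i=1}^n\mathbf 1[g(x_i^s)=1]-\frac1n\sum_{i=1}^n\mathbf 1[g(x_i^t)=1]\Big|,$$ $$\gamma(\mathcal Z_S,\mathcal Z_T)=\min_{h^*\in\mathcal H}\big[L^{0/1}(h^*;\mathcal Z_S)+L^{0/1}(h^*;\mathcal Z_T)\big].$$ There is an absolute constant $C>0$ such that the following holds in every such setting. Assume $\mathrm{VC}(\mathcal H)<\infty$, $\mathrm{AVC}(\mathcal H)<\infty$, and the usual measurability of $\{\ell_h:h\in\mathcal H\}$: each $\ell_h$ is $\mathcal D_T$-measurable, and for all $m$ and $e\in\mathbb R^m$ the function $(z_1,\dots,z_m)\mapsto\sup_{h\in\mathcal H}\big|\sum_{i=1}^m e_i\,\ell_h(z_i)\big|$ is measurable for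 the completion of $\mathcal D_T^m$. Let $n\ge2$ and $\delta\in(0,1)$, and let $\mathcal Z_S=((x_i^s,y_i^s))_{i=1}^n$ and $\mathcal Z_T=((x_i^t,y_i^t))_{i=1}^n$ be independent samples drawn i.i.d. from $\mathcal D_S$ and $\mathcal D_T$, respectively. Then, with probability at least $1-\delta$ (that is, the exceptional event has outer probability at most $\delta$), for all $h\in\mathcal H$, $$L^{0/1}_{\rm adv}(h;\mathcal D_T)\le L^{0/1}(h;\mathcal Z_S)+\sup_{\tilde x_i^t\in\mathcal B(x_i^t),\ i=1,\dots,n}\Big[d_{\mathcal H\Delta\mathcal H}(\mathrm X_S,\tilde{\mathrm X}_T)+2\gamma(\mathcal Z_S,\tilde{\mathcal Z}_T)\Big]+\epsilon,$$ where $\tilde{\mathrm X}_T=(\tilde x_i^t)_{i=1}^n$, $\tilde{\mathcal Z}_T=((\tilde x_i^t,y_i^t))_{i=1}^n$ and $$\epsilon=C\sqrt{\frac{\max\{\mathrm{VC}(\mathcal H),\mathrm{AVC}(\mathcal H)\}\log n+\log(1/\delta)}{n}}.$$ -/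

import Mathlib

open MeasureTheory

universe u

/-! Binary labels are encoded by `Bool` (`true` is the label `+1`, `false` is the label `-1`),
a hypothesis is a map `h : X → Bool`, and a hypothesis class is a set of such maps. -/

/-- A class `F` of `{0,1}`-valued functions shatters the finite set `S`:
every labelling of `S` is realized by a member of `F`. -/
def ShattersSet {α : Type u} (F : Set (α → Bool)) (S : Finset α) : Prop :=
  ∀ g : α → Bool, ∃ f ∈ F, ∀ a ∈ S, f a = g a

/-- The VC dimension: the supremum (possibly `⊤`) of the sizes of the shattered finite sets. -/
noncomputable def vcDimension {α : Type u} (F : Set (α → Bool)) : ℕ∞ :=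
  ⨆ S : {S : Finset α // ShattersSet F S}, (S.1.card : ℕ∞)

/-- The 0-1 loss. -/
def zeroOneLoss (a b : Bool) : ℝ := if a = b then 0 else 1

/-- The adversarial 0-1 loss of `h` at the labelled example `z = (x, y)`:
the supremum of the 0-1 loss of `h` over the perturbation set `B x`. -/
noncomputable def advZeroOneLoss {X : Type u} (B : X → Set X) (h : X → Bool) (z : X × Bool) : ℝ :=
  ⨆ x' : B z.1, zeroOneLoss (h x') z.2

/-- The adversarial 0-1 loss class, as real-valued functions on labelled examples. -/
def advLossClass {X : Type u} (B : X → Set X) (H : Set (X → Bool)) : Set (X × Bool → ℝ) :=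
  {f | ∃ h ∈ H, f = advZeroOneLoss B h}

open Classical in
/-- The adversarial VC dimension: the VC dimension of the class of the functions
`(x, y) ↦ 𝟙[h x' ≠ y for some x' ∈ B x]`, `h ∈ H`, on labelled examples, that is, of the 0-1 loss
class of the corrupted classifiers (which give the label that `h` takes on all of `B x`,
or an error symbol if `h` is not constant on `B x`). -/
noncomputable def advVCDimension {X : Type u} (B : X → Set X) (H : Set (X → Bool)) : ℕ∞ :=
  vcDimension {f : X × Bool → Bool | ∃ h ∈ H, ∀ z, f z = decide (∃ x' ∈ B z.1, h x' ≠ z.2)}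

/-- The adversarial 0-1 loss of `h` on a distribution `D` of labelled examples. -/
noncomputable def advRisk {X : Type u} [MeasurableSpace X] (B : X → Set X) (h : X → Bool)
    (D : Measure (X × Bool)) : ℝ :=
  ∫ z, advZeroOneLoss B h z ∂D

/-- The empirical 0-1 loss of `h` on a labelled sample. -/
noncomputable def empRisk {X : Type u} {n : ℕ} (h : X → Bool) (Z : Fin n → X × Bool) : ℝ :=
  (1 / (n : ℝ)) * ∑ i, zeroOneLoss (h (Z i).1) (Z i).2

/-- The symmetric difference class: all `x ↦ h₁ x ⊕ h₂ x` with `h₁, h₂ ∈ H`. -/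
def symmDiffClass {X : Type u} (H : Set (X → Bool)) : Set (X → Bool) :=
  {g | ∃ h₁ ∈ H, ∃ h₂ ∈ H, g = fun x => xor (h₁ x) (h₂ x)}

/-- The fraction of the sample points at which `g` takes the value `1`. -/
noncomputable def empFreq {X : Type u} {n : ℕ} (g : X → Bool) (x : Fin n → X) : ℝ :=
  (1 / (n : ℝ)) * ∑ i, (if g (x i) = true then 1 else 0)

/-- The empirical divergence of two unlabelled samples with respect to the symmetric difference
class of `H`. -/
noncomputable def empDivergence {X : Type u} {n : ℕ} (H : Set (X → Bool)) (xS xT : Fin n → X) : ℝ :=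
  2 * ⨆ g : symmDiffClass H, |empFreq g.1 xS - empFreq g.1 xT|

/-- The empirical ideal joint loss of two labelled samples. -/
noncomputable def empJointLoss {X : Type u} {n : ℕ} (H : Set (X → Bool))
    (ZS ZT : Fin n → X × Bool) : ℝ :=
  ⨅ h : H, (empRisk h.1 ZS + empRisk h.1 ZT)

/-- The worst-case target term: the supremum, over all perturbations `x' i ∈ B (x i)` of the target
inputs (the labels are kept), of the divergence plus twice the ideal joint loss. -/
noncomputable def worstCaseTarget {X : Type u} {n : ℕ} (B : X → Set X) (H : Set (X → Bool))
    (ZS ZT : Fin n → X × Bool) : ℝ :=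
  ⨆ x' : {x' : Fin n → X // ∀ i, x' i ∈ B (ZT i).1},
    (empDivergence H (fun i => (ZS i).1) x'.1
      + 2 * empJointLoss H ZS (fun i => (x'.1 i, (ZT i).2)))

/-- The usual measurability convention of empirical process theory (a `P`-measurable class):
the members of `F` are measurable, and so are the suprema over `F` of weighted sums over a sample,
on the completion of the law of the sample. -/
def IsMeasurableClass {Z : Type u} [MeasurableSpace Z] (F : Set (Z → ℝ)) (P : Measure Z) : Prop :=
  (∀ f ∈ F, AEMeasurable f P) ∧
    ∀ (m : ℕ) (e : Fin m → ℝ),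
      AEMeasurable (fun z : Fin m → Z => ⨆ f : F, |∑ i, e i * f.1 (z i)|)
        (Measure.pi fun _ : Fin m => P)

/-! ### Shattering and growth -/

/-! The bound splits into a deterministic comparison and a uniform law of large numbers for the
target sample alone.

For a fixed `h`, pick for each target point a perturbation attaining the adversarial loss. The mean
adversarial loss is then the ordinary empirical loss of `h` on a perturbed sample, one competitor in
the worst-case supremum, and the triangle inequality through an arbitrary `k ∈ H` transfers this
loss to the source sample (`mean_advZeroOneLoss_le`). This holds for all samples.

What remains is the one-sided deviation of the adversarial loss class
(`measure_exists_integral_gt_mean_add_le`). A ghost sample replaces the expectation by a second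
empirical mean, random swaps between the two samples turn the difference into Rademacher sums,
Sauer–Shelah leaves at most `(2 * n + 1) ^ d` sums, and each has a sub-Gaussian tail. -/

theorem Nat.sum_choose_Iic_le_pow (N d : ℕ) : ∑ k ∈ Finset.Iic d, N.choose k ≤ (N + 1) ^ d := by
  rw [add_pow, ← Nat.range_succ_eq_Iic]
  refine Finset.sum_le_sum fun k hk => ?_
  have h1 : 1 ≤ d.choose k := Nat.choose_pos (by simpa [Nat.lt_succ_iff] using hk)
  simpa using (Nat.choose_le_pow N k).trans (Nat.le_mul_of_pos_right _ h1)

theorem ShattersSet.card_le_toNat_vcDimension {α : Type u} {F : Set (α → Bool)}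
    (hF : vcDimension F ≠ ⊤) {S : Finset α} (hS : ShattersSet F S) :
    S.card ≤ (vcDimension F).toNat := by
  have h : (S.card : ℕ∞) ≤ vcDimension F :=
    le_iSup (fun S : {S : Finset α // ShattersSet F S} => (S.1.card : ℕ∞)) ⟨S, hS⟩
  simpa using ENat.toNat_le_toNat h hF

/-- A Sauer–Shelah bound for the number of traces of a class on a tuple of points. -/
theorem exists_traces_card_le {α : Type u} {ι : Type*} [Fintype ι] {F : Set (α → Bool)}
    (hF : vcDimension F ≠ ⊤) (w : ι → α) :
    ∃ T : Finset (ι → Bool), (∀ f ∈ F, f ∘ w ∈ T) ∧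
      T.card ≤ (Fintype.card ι + 1) ^ (vcDimension F).toNat := by
  classical
  set T : Finset (ι → Bool) := Finset.univ.filter fun g => ∃ f ∈ F, f ∘ w = g with hT
  set A : Finset (Finset ι) := T.image fun g => Finset.univ.filter fun i => g i = true with hA
  have hTA : T.card = A.card := by
    refine (Finset.card_image_of_injective _ fun g g' h => funext fun i => ?_).symm
    have := Finset.ext_iff.1 h i
    simp only [Finset.mem_filter, Finset.mem_univ, true_and] at this
    exact Bool.eq_iff_iff.2 this
  have trace : ∀ s, A.Shatters s → ∀ t ⊆ s, ∃ f ∈ F, ∀ i ∈ s, (i ∈ t ↔ f (w i) = true) := by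
    intro s hs t ht
    obtain ⟨v, hv, hvt⟩ := hs ht
    obtain ⟨g, hg, rfl⟩ := Finset.mem_image.1 hv
    obtain ⟨f, hf, rfl⟩ := (Finset.mem_filter.1 hg).2
    refine ⟨f, hf, fun i hi => ?_⟩
    rw [← hvt]
    simp [hi]
  have key : A.vcDim ≤ (vcDimension F).toNat := by
    refine Finset.sup_le fun s hs => ?_
    have hs' := Finset.mem_shatterer.1 hs
    -- The traces live on indices, and `w` may repeat points. Two indices of one point are never
    -- separated, whereas shattering cuts out `{i}`; hence a shattered index set maps injectively
    -- onto a shattered set of points.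
    have inj : Set.InjOn w s := by
      intro i hi j hj hij
      obtain ⟨f, -, h⟩ := trace s hs' {i} (by simpa using hi)
      have h1 := h i hi
      have h2 := h j hj
      rw [← hij, ← h1] at h2
      exact (Finset.mem_singleton.1 (h2.2 (Finset.mem_singleton_self i))).symm
    rw [← Finset.card_image_of_injOn inj]
    refine ShattersSet.card_le_toNat_vcDimension hF fun g => ?_
    obtain ⟨f, hf, h⟩ := trace s hs' (s.filter fun i => g (w i) = true) (Finset.filter_subset _ _)
    refine ⟨f, hf, fun a ha => ?_⟩
    obtain ⟨i, hi, rfl⟩ := Finset.mem_image.1 ha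
    have := h i hi
    rw [Bool.eq_iff_iff, ← this]
    simp [hi]
  refine ⟨T, fun f hf => by simpa [hT] using ⟨f, hf, rfl⟩, ?_⟩
  rw [hTA]
  calc A.card ≤ A.shatterer.card := Finset.card_le_card_shatterer A
    _ ≤ ∑ k ∈ Finset.Iic A.vcDim, (Fintype.card ι).choose k := Finset.card_shatterer_le_sum_vcDim
    _ ≤ (Fintype.card ι + 1) ^ A.vcDim := Nat.sum_choose_Iic_le_pow _ _
    _ ≤ _ := Nat.pow_le_pow_right (by simp) key

/-- A class of vanishing VC dimension has at most one member. -/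
theorem eq_of_toNat_vcDimension_eq_zero {α : Type u} {F : Set (α → Bool)}
    (hF : vcDimension F ≠ ⊤) (h0 : (vcDimension F).toNat = 0) {f g : α → Bool}
    (hf : f ∈ F) (hg : g ∈ F) : f = g := by
  funext a
  by_contra hne
  have hS : ShattersSet F {a} := by
    intro b
    by_cases h : f a = b a
    · exact ⟨f, hf, by simpa using h⟩
    · refine ⟨g, hg, ?_⟩
      simp only [Finset.mem_singleton, forall_eq]
      revert hne h
      cases f a <;> cases g a <;> cases b a <;> simp
  simpa [h0] using hS.card_le_toNat_vcDimension hF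

/-! ### Rademacher sums -/

/-- The sum over signs factorizes, and each factor is `2 * cosh (t * a i)`, at most `2 * exp (t ^ 2
/ 2)`. -/
theorem sum_exp_rademacher_le {n : ℕ} (a : Fin n → ℝ) (ha : ∀ i, |a i| ≤ 1) (t : ℝ) :
    ∑ σ : Fin n → Bool, Real.exp (t * ∑ i, (if σ i then 1 else -1) * a i)
      ≤ 2 ^ n * Real.exp (n * t ^ 2 / 2) := by
  have h1 : ∑ σ : Fin n → Bool, Real.exp (t * ∑ i, (if σ i then 1 else -1) * a i)
      = ∏ i, ∑ b : Bool, Real.exp (t * ((if b then 1 else -1) * a i)) := by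
    rw [Finset.prod_univ_sum, Fintype.piFinset_univ]
    refine Finset.sum_congr rfl fun σ _ => ?_
    rw [Finset.mul_sum, Real.exp_sum]
  rw [h1]
  calc _ ≤ ∏ _i : Fin n, (2 * Real.exp (t ^ 2 / 2)) := by
        refine Finset.prod_le_prod (fun i _ => by positivity) fun i _ => ?_
        have h2 := Real.cosh_le_exp_half_sq (t * a i)
        have h3 : (t * a i) ^ 2 / 2 ≤ t ^ 2 / 2 := by
          have : a i ^ 2 ≤ 1 := (sq_le_one_iff_abs_le_one _).2 (ha i)
          rw [mul_pow]
          nlinarith [sq_nonneg t]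
        have h4 := Real.exp_le_exp.2 h3
        rw [Real.cosh_eq] at h2
        simp only [Fintype.sum_bool, if_true, Bool.false_eq_true, if_false, one_mul, neg_mul,
          mul_neg]
        linarith
    _ = _ := by
        rw [Finset.prod_const, Finset.card_univ, Fintype.card_fin, mul_pow, ← Real.exp_nat_mul]
        ring_nf

/-- Chernoff's method with the optimal parameters `t = r` and `t = -r`, one for each tail; signs are
counted because the swaps form a finite set. -/
theorem card_rademacher_gt_le {n : ℕ} (a : Fin n → ℝ) (ha : ∀ i, |a i| ≤ 1)
    {r : ℝ} (hr : 0 ≤ r) :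
    ((Finset.univ.filter fun σ : Fin n → Bool =>
        n * r < |∑ i, (if σ i then 1 else -1) * a i|).card : ℝ)
      ≤ 2 * 2 ^ n * Real.exp (-(n * r ^ 2 / 2)) := by
  set S : (Fin n → Bool) → ℝ := fun σ => ∑ i, (if σ i then 1 else -1) * a i with hS
  have h1 : ((Finset.univ.filter fun σ : Fin n → Bool => n * r < |S σ|).card : ℝ)
      * Real.exp (n * r ^ 2) ≤ ∑ σ, (Real.exp (r * S σ) + Real.exp (-r * S σ)) := by
    rw [← nsmul_eq_mul, ← Finset.sum_const, Finset.sum_filter]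
    refine Finset.sum_le_sum fun σ _ => ?_
    split_ifs with h
    · rcases lt_abs.1 h with h | h
      · have : Real.exp (n * r ^ 2) ≤ Real.exp (r * S σ) := Real.exp_le_exp.2 (by nlinarith)
        linarith [Real.exp_pos (-r * S σ)]
      · have : Real.exp (n * r ^ 2) ≤ Real.exp (-r * S σ) := Real.exp_le_exp.2 (by nlinarith)
        linarith [Real.exp_pos (r * S σ)]
    · positivity
  have h2 : ∑ σ, (Real.exp (r * S σ) + Real.exp (-r * S σ))
      ≤ 2 * 2 ^ n * Real.exp (n * r ^ 2 / 2) := by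
    rw [Finset.sum_add_distrib]
    have h3 := sum_exp_rademacher_le a ha r
    have h4 := sum_exp_rademacher_le a ha (-r)
    rw [neg_sq] at h4
    linarith
  rw [← mul_le_mul_iff_of_pos_right (Real.exp_pos (n * r ^ 2)), mul_assoc (2 * 2 ^ n),
    ← Real.exp_add]
  refine (h1.trans h2).trans (le_of_eq ?_)
  ring_nf

/-! ### Hoeffding's inequality for empirical means -/

theorem measure_integral_sub_mean_ge_le {Z : Type*} [MeasurableSpace Z] (P : Measure Z)
    [IsProbabilityMeasure P] {f : Z → ℝ} (hf : AEMeasurable f P) (h01 : ∀ z, f z ∈ Set.Icc 0 1)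
    {n : ℕ} (hn : 0 < n) {r : ℝ} (hr : 0 ≤ r) :
    (Measure.pi fun _ : Fin n => P) {z | r ≤ ∫ x, f x ∂P - (1 / (n : ℝ)) * ∑ i, f (z i)}
      ≤ ENNReal.ofReal (Real.exp (-(2 * n * r ^ 2))) := by
  have hn' : (0 : ℝ) < n := Nat.cast_pos.2 hn
  -- Passing to `-f`, with values in `[-1, 0]`, makes this an upper tail; the variance proxy `1 / 4`
  -- gives the exponent `2 * n * r ^ 2`.
  have hg : AEMeasurable (fun x => -f x) P := hf.neg
  have hsub := ProbabilityTheory.hasSubgaussianMGF_of_mem_Icc (a := -1) (b := 0) hg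
    (Filter.Eventually.of_forall fun z => by
      have := h01 z
      exact ⟨by linarith [this.2], by linarith [this.1]⟩)
  have hY : AEMeasurable (fun x => -f x - ∫ x, -f x ∂P) P := hg.sub_const _
  have hind := ProbabilityTheory.iIndepFun_pi (ι := Fin n) (μ := fun _ => P)
    (X := fun _ x => -f x - ∫ x, -f x ∂P) fun _ => hY
  have hs : ∀ i ∈ (Finset.univ : Finset (Fin n)), ProbabilityTheory.HasSubgaussianMGF
      (fun z : Fin n → Z => -f (z i) - ∫ x, -f x ∂P) ((‖(0 : ℝ) - -1‖₊ / 2) ^ 2)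
      (Measure.pi fun _ : Fin n => P) := by
    intro i _
    refine ProbabilityTheory.HasSubgaussianMGF.of_map
      (X := fun x => -f x - ∫ x, -f x ∂P) (Y := fun z : Fin n → Z => z i)
      (measurable_pi_apply i).aemeasurable ?_
    rw [(measurePreserving_eval (fun _ : Fin n => P) i).map_eq]
    exact hsub
  have H := ProbabilityTheory.HasSubgaussianMGF.measure_sum_ge_le_of_iIndepFun hind hs
    (ε := n * r) (by positivity)
  rw [measureReal_def, ← ENNReal.le_ofReal_iff_toReal_le (measure_ne_top _ _) (by positivity)] at H
  refine (measure_mono ?_).trans (H.trans (ENNReal.ofReal_le_ofReal (Real.exp_le_exp.2 ?_)))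
  · intro z hz
    simp only [Set.mem_ofPred_eq, integral_neg, Finset.sum_sub_distrib, Finset.sum_neg_distrib,
      Finset.sum_const, Finset.card_univ, Fintype.card_fin, nsmul_eq_mul] at hz ⊢
    have := mul_le_mul_of_nonneg_left hz hn'.le
    have e : (n : ℝ) * (∫ x, f x ∂P - (1 / (n : ℝ)) * ∑ i, f (z i))
        = n * ∫ x, f x ∂P - ∑ i, f (z i) := by field_simp
    linarith
  · apply le_of_eq
    simp
    field_simp

/-! ### Symmetrization -/

theorem measurePreserving_pi_reindex {ι ι' Z : Type*} [Fintype ι] [Fintype ι'] [MeasurableSpace Z]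
    (P : Measure Z) [SigmaFinite P] (e : ι ≃ ι') :
    MeasurePreserving (fun (w : ι' → Z) i => w (e i))
      (Measure.pi fun _ : ι' => P) (Measure.pi fun _ : ι => P) := by
  have h := measurePreserving_piCongrLeft (α := fun _ : ι => Z) (fun _ => P) e.symm
  convert h using 1
  funext w i
  obtain ⟨j, rfl⟩ := e.symm.surjective i
  simp [MeasurableEquiv.coe_piCongrLeft, Equiv.piCongrLeft_apply_apply]

/-- A set that contains few of the images of every point under finitely many measure preserving
maps has small measure. -/
theorem card_mul_measure_le_of_measurePreserving {α κ : Type*} [MeasurableSpace α] [Fintype κ]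
    {μ : Measure α} [IsProbabilityMeasure μ] {T : κ → α → α}
    (hT : ∀ i, MeasurePreserving (T i) μ μ) {F : Set α} (hF : NullMeasurableSet F μ)
    [∀ w, DecidablePred fun i => T i w ∈ F] {k : ENNReal}
    (hk : ∀ w, ((Finset.univ.filter fun i => T i w ∈ F).card : ENNReal) ≤ k) :
    Fintype.card κ * μ F ≤ k := by
  have hTF : ∀ i, NullMeasurableSet (T i ⁻¹' F) μ := fun i =>
    hF.preimage (hT i).quasiMeasurePreserving
  calc Fintype.card κ * μ F = ∑ i, μ (T i ⁻¹' F) := by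
        simp [fun i => (hT i).measure_preimage hF]
    _ = ∑ i, ∫⁻ w, (T i ⁻¹' F).indicator 1 w ∂μ := by
        simp_rw [fun i => lintegral_indicator_one₀ (hTF i)]
    _ = ∫⁻ w, ∑ i, (T i ⁻¹' F).indicator 1 w ∂μ :=
        (lintegral_finsetSum' _ fun i _ => aemeasurable_one.indicator₀ (hTF i)).symm
    _ ≤ ∫⁻ _, k ∂μ := by
        refine lintegral_mono fun w => le_trans (le_of_eq ?_) (hk w)
        rw [Finset.card_filter, Nat.cast_sum]
        refine Finset.sum_congr rfl fun i _ => ?_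
        by_cases h : T i w ∈ F <;> simp [h]
    _ = k := by simp

/-- The permutation of a double sample that exchanges the `i`-th points where `σ i` is `false`. -/
def swapPerm {n : ℕ} (σ : Fin n → Bool) : Fin n ⊕ Fin n ≃ Fin n ⊕ Fin n :=
  Function.Involutive.toPerm
    (Sum.elim (fun i => if σ i then Sum.inl i else Sum.inr i)
      (fun i => if σ i then Sum.inr i else Sum.inl i))
    (by rintro (i | i) <;> cases h : σ i <;> simp [h])

/-- The `{0, 1}`-valued real functions of a class of Boolean functions. -/
def realClass {Z : Type u} (F : Set (Z → Bool)) : Set (Z → ℝ) :=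
  (fun f z => if f z = true then (1 : ℝ) else 0) '' F

theorem realClass_mem_Icc {Z : Type u} {F : Set (Z → Bool)} {f : Z → ℝ} (hf : f ∈ realClass F)
    (z : Z) : f z ∈ Set.Icc (0 : ℝ) 1 := by
  obtain ⟨g, -, rfl⟩ := hf
  dsimp only
  split_ifs <;> simp

/-- The largest discrepancy between the two halves of a double sample. -/
noncomputable def doubleSampleGap {Z : Type u} {n : ℕ} (G : Set (Z → ℝ))
    (w : Fin n ⊕ Fin n → Z) : ℝ :=
  ⨆ f : G, |∑ i, (f.1 (w (Sum.inr i)) - f.1 (w (Sum.inl i)))|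

theorem abs_sub_le_one_of_mem_realClass {Z : Type u} {F : Set (Z → Bool)} {f : Z → ℝ}
    (hf : f ∈ realClass F) (x y : Z) : |f x - f y| ≤ 1 := by
  have h1 := realClass_mem_Icc hf x
  have h2 := realClass_mem_Icc hf y
  exact abs_le.2 ⟨by linarith [h1.1, h2.2], by linarith [h1.2, h2.1]⟩

theorem bddAbove_doubleSampleGap {Z : Type u} {n : ℕ} (F : Set (Z → Bool))
    (w : Fin n ⊕ Fin n → Z) :
    BddAbove (Set.range fun f : realClass F =>
      |∑ i, (f.1 (w (Sum.inr i)) - f.1 (w (Sum.inl i)))|) := by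
  refine ⟨n, ?_⟩
  rintro _ ⟨f, rfl⟩
  refine (Finset.abs_sum_le_sum_abs _ _).trans ?_
  refine (Finset.sum_le_sum fun i _ => abs_sub_le_one_of_mem_realClass f.2 _ _).trans ?_
  simp

/-- The gap is a weighted sum over one sample of size `n + n`, with weights `-1` on the first half
and `1` on the second. -/
theorem aemeasurable_doubleSampleGap {Z : Type u} [MeasurableSpace Z] {P : Measure Z}
    [IsProbabilityMeasure P] {G : Set (Z → ℝ)} (hG : IsMeasurableClass G P) (n : ℕ) :
    AEMeasurable (doubleSampleGap (n := n) G) (Measure.pi fun _ : Fin n ⊕ Fin n => P) := by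
  have h := (hG.2 (n + n) (fun j => Sum.elim (fun _ => -1) (fun _ => 1)
    (finSumFinEquiv.symm j))).comp_quasiMeasurePreserving
      (measurePreserving_pi_reindex P
        (finSumFinEquiv (m := n) (n := n)).symm).quasiMeasurePreserving
  convert h using 1
  funext w
  unfold doubleSampleGap
  simp only [Function.comp_def]
  congr 1
  funext f
  congr 1
  rw [← finSumFinEquiv.sum_comp]
  simp only [Equiv.symm_apply_apply, Fintype.sum_sum_type, Sum.elim_inl, Sum.elim_inr,
    Finset.sum_sub_distrib, neg_mul, one_mul, Finset.sum_neg_distrib]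
  ring

/-- A swap preserves the law of the double sample and flips the sign of the swapped differences. For
fixed `w` the sums depend only on the trace of `f` on `w`, so a union bound over traces counts the
bad swaps. -/
theorem measure_doubleSampleGap_gt_le {Z : Type u} [MeasurableSpace Z] {P : Measure Z}
    [IsProbabilityMeasure P] {F : Set (Z → Bool)} (hne : F.Nonempty) (hF : vcDimension F ≠ ⊤)
    (hm : IsMeasurableClass (realClass F) P) (n : ℕ) {r : ℝ} (hr : 0 ≤ r) :
    (Measure.pi fun _ : Fin n ⊕ Fin n => P) {w | n * r < doubleSampleGap (realClass F) w}
      ≤ ENNReal.ofReal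
          (2 * (2 * n + 1) ^ (vcDimension F).toNat * Real.exp (-(n * r ^ 2 / 2))) := by
  classical
  set d := (vcDimension F).toNat
  set b : ℝ := 2 * 2 ^ n * Real.exp (-(n * r ^ 2 / 2)) with hb
  have hb0 : 0 ≤ b := by positivity
  have hne' : Nonempty (realClass F) := (hne.image _).to_subtype
  have hnull : NullMeasurableSet {w | n * r < doubleSampleGap (n := n) (realClass F) w}
      (Measure.pi fun _ : Fin n ⊕ Fin n => P) :=
    (aemeasurable_doubleSampleGap hm n).nullMeasurableSet_preimage measurableSet_Ioi
  have hcount : ∀ w : Fin n ⊕ Fin n → Z,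
      ((Finset.univ.filter fun σ : Fin n → Bool => (fun i => w (swapPerm σ i)) ∈
        {w | n * r < doubleSampleGap (n := n) (realClass F) w}).card : ENNReal)
        ≤ ENNReal.ofReal ((2 * n + 1) ^ d * b) := by
    intro w
    obtain ⟨T, hT, hTc⟩ := exists_traces_card_le hF w
    set a : (Fin n ⊕ Fin n → Bool) → Fin n → ℝ := fun g i =>
      (if g (Sum.inr i) = true then 1 else 0) - (if g (Sum.inl i) = true then 1 else 0) with ha
    have ha1 : ∀ g i, |a g i| ≤ 1 := by
      intro g i
      simp only [ha]
      split_ifs <;> simp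
    have hsub : (Finset.univ.filter fun σ : Fin n → Bool => (fun i => w (swapPerm σ i)) ∈
        {w | n * r < doubleSampleGap (n := n) (realClass F) w}) ⊆
        T.biUnion fun g => Finset.univ.filter fun σ : Fin n → Bool =>
          n * r < |∑ i, (if σ i then 1 else -1) * a g i| := by
      intro σ hσ
      simp only [Finset.mem_filter, Finset.mem_univ, true_and, Set.mem_ofPred_eq,
        doubleSampleGap] at hσ
      obtain ⟨⟨_, f, hf, rfl⟩, hlt⟩ := exists_lt_of_lt_ciSup hσ
      simp only [Finset.mem_biUnion, Finset.mem_filter, Finset.mem_univ, true_and]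
      refine ⟨f ∘ w, hT f hf, lt_of_lt_of_eq hlt ?_⟩
      congr 1
      refine Finset.sum_congr rfl fun i _ => ?_
      cases h : σ i <;> simp [swapPerm, h, ha, Function.Involutive.toPerm]
    have hreal : ((Finset.univ.filter fun σ : Fin n → Bool => (fun i => w (swapPerm σ i)) ∈
        {w | n * r < doubleSampleGap (n := n) (realClass F) w}).card : ℝ)
        ≤ (2 * n + 1) ^ d * b := by
      calc _ ≤ ∑ g ∈ T, ((Finset.univ.filter fun σ : Fin n → Bool =>
              n * r < |∑ i, (if σ i then 1 else -1) * a g i|).card : ℝ) := by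
            exact_mod_cast (Finset.card_le_card hsub).trans Finset.card_biUnion_le
        _ ≤ ∑ _g ∈ T, b := Finset.sum_le_sum fun g _ => card_rademacher_gt_le _ (ha1 g) hr
        _ = T.card * b := by simp
        _ ≤ _ := by
            refine mul_le_mul_of_nonneg_right ?_ hb0
            have : (T.card : ℝ) ≤ ((Fintype.card (Fin n ⊕ Fin n) + 1) ^ d : ℕ) :=
              Nat.cast_le.2 hTc
            refine this.trans (le_of_eq ?_)
            simp [two_mul]
    rw [← ENNReal.ofReal_natCast]
    exact ENNReal.ofReal_le_ofReal hreal
  have H := card_mul_measure_le_of_measurePreserving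
    (fun σ : Fin n → Bool => measurePreserving_pi_reindex P (swapPerm σ)) hnull hcount
  have h2 : (Fintype.card (Fin n → Bool) : ENNReal) = ENNReal.ofReal (2 ^ n) := by
    simp [ENNReal.ofReal_pow]
  have hpos : (0 : ℝ) < 2 ^ n := by positivity
  rw [h2, mul_comm, ← ENNReal.le_div_iff_mul_le (by simp) (by simp),
    ← ENNReal.ofReal_div_of_pos hpos] at H
  refine H.trans (ENNReal.ofReal_le_ofReal (le_of_eq ?_))
  rw [hb]
  field_simp

/-- Symmetrization by a ghost sample. -/
theorem measure_exists_integral_sub_mean_gt_le {Z : Type u} [MeasurableSpace Z] {P : Measure Z}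
    [IsProbabilityMeasure P] {F : Set (Z → Bool)} (hm : IsMeasurableClass (realClass F) P)
    {n : ℕ} (hn : 0 < n) {r : ℝ} (hr : 0 ≤ r) (hnr : Real.exp (-(2 * n * r ^ 2)) ≤ 1 / 2) :
    (Measure.pi fun _ : Fin n => P)
        {z | ∃ f ∈ realClass F, 2 * r < ∫ x, f x ∂P - (1 / (n : ℝ)) * ∑ i, f (z i)}
      ≤ 2 * (Measure.pi fun _ : Fin n ⊕ Fin n => P)
          {w | n * r < doubleSampleGap (realClass F) w} := by
  have hn' : (0 : ℝ) < n := Nat.cast_pos.2 hn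
  set μ := Measure.pi fun _ : Fin n => P
  set A := {w : Fin n ⊕ Fin n → Z | n * r < doubleSampleGap (realClass F) w}
  have hp := measurePreserving_sumPiEquivProdPi_symm
    (X := fun _ : Fin n ⊕ Fin n => Z) (fun _ => P)
  set e := (MeasurableEquiv.sumPiEquivProdPi fun _ : Fin n ⊕ Fin n => Z).symm
  -- The measurable hull has the same measure, and its sections are measurable, as Tonelli and
  -- Markov require.
  set K := toMeasurable (μ.prod μ) (e ⁻¹' A)
  have hK : MeasurableSet K := measurableSet_toMeasurable _ _
  have hKA : μ.prod μ K = (Measure.pi fun _ : Fin n ⊕ Fin n => P) A := by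
    rw [measure_toMeasurable]
    exact hp.measure_preimage_equiv A
  rw [← hKA, Measure.prod_apply hK]
  have hmark := mul_meas_ge_le_lintegral (μ := μ) (measurable_measure_prodMk_left hK (ν := μ))
    (1 / 2)
  have hstep : μ {z | ∃ f ∈ realClass F, 2 * r < ∫ x, f x ∂P - (1 / (n : ℝ)) * ∑ i, f (z i)}
      ≤ μ {z | 1 / 2 ≤ μ (Prod.mk z ⁻¹' K)} := by
    refine measure_mono ?_
    rintro z ⟨f, hf, hz⟩
    have hfm := hm.1 f hf
    have hH := measure_integral_sub_mean_ge_le P hfm (realClass_mem_Icc hf) hn hr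
    have hnull : NullMeasurableSet
        {z : Fin n → Z | r ≤ ∫ x, f x ∂P - (1 / (n : ℝ)) * ∑ i, f (z i)} μ := by
      have : AEMeasurable
          (fun z : Fin n → Z => ∫ x, f x ∂P - (1 / (n : ℝ)) * ∑ i, f (z i)) μ := by
        refine ((Finset.aemeasurable_fun_sum _ fun i _ => ?_).const_mul _).const_sub _
        exact hfm.comp_quasiMeasurePreserving (Measure.quasiMeasurePreserving_eval _ i)
      exact this.nullMeasurableSet_preimage measurableSet_Ici
    have hcompl := prob_compl_eq_one_sub₀ hnull
    have hle : (1 / 2 : ENNReal) ≤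
        μ {z : Fin n → Z | r ≤ ∫ x, f x ∂P - (1 / (n : ℝ)) * ∑ i, f (z i)}ᶜ := by
      rw [hcompl]
      have h12 : μ {z : Fin n → Z | r ≤ ∫ x, f x ∂P - (1 / (n : ℝ)) * ∑ i, f (z i)}
          ≤ 1 / 2 := by
        refine hH.trans ((ENNReal.ofReal_le_ofReal hnr).trans ?_)
        rw [ENNReal.ofReal_div_of_pos (by norm_num)]
        simp
      refine le_trans (le_of_eq ?_) (tsub_le_tsub_left h12 1)
      simp [ENNReal.one_sub_inv_two]
    -- If the sample deviates by more than `2 * r` and the ghost sample by less than `r`, their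
    -- means differ by more than `r`; the latter has probability at least `1 / 2`.
    refine hle.trans (measure_mono fun z' hz' => subset_toMeasurable _ _ ?_)
    have hz'' : ∫ x, f x ∂P - (1 / (n : ℝ)) * ∑ i, f (z' i) < r := not_le.1 hz'
    change n * r < doubleSampleGap (realClass F) (e (z, z'))
    refine lt_of_lt_of_le ?_ (le_ciSup (bddAbove_doubleSampleGap F (e (z, z'))) ⟨f, hf⟩)
    refine lt_of_lt_of_le ?_ (le_abs_self _)
    change n * r < ∑ i, (f (z' i) - f (z i))
    rw [Finset.sum_sub_distrib]
    have h3 : r < (1 / (n : ℝ)) * (∑ i, f (z' i) - ∑ i, f (z i)) := by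
      rw [mul_sub]; linarith
    have h4 := mul_lt_mul_of_pos_left h3 hn'
    rwa [← mul_assoc, mul_one_div_cancel hn'.ne', one_mul] at h4
  calc _ ≤ _ := hstep
    _ = 2 * (1 / 2 * μ {z | 1 / 2 ≤ μ (Prod.mk z ⁻¹' K)}) := by
        rw [← mul_assoc, one_div, ENNReal.mul_inv_cancel (by simp) (by simp), one_mul]
    _ ≤ _ := by gcongr

/-! ### The uniform deviation bound -/

/-- The exponent `8` is spent as `3 + 5`: for `n ≥ 2`, `2 * n + 1 ≤ n ^ 3` absorbs the growth
function and `4 ≤ n ^ (5 * d)` the constant. -/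
theorem four_mul_growth_mul_exp_le {n d : ℕ} (hn : 2 ≤ n) (hd : 1 ≤ d) {δ L : ℝ} (hδ : 0 < δ)
    (hδ1 : δ < 1) (hL : d * Real.log n + Real.log (1 / δ) ≤ L) :
    2 * (2 * (2 * n + 1) ^ d * Real.exp (-(8 * L))) ≤ δ := by
  have hn2 : (2 : ℝ) ≤ n := by exact_mod_cast hn
  have hn0 : (0 : ℝ) < n := by linarith
  have hl : 0 < Real.log (1 / δ) := Real.log_pos (by rw [lt_div_iff₀ hδ]; linarith)
  have h1 : Real.exp (-(8 * L)) ≤ δ / (n : ℝ) ^ (8 * d) := by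
    have e : δ / (n : ℝ) ^ (8 * d) = Real.exp (-(8 * (d * Real.log n)) - Real.log (1 / δ)) := by
      rw [Real.exp_sub, Real.exp_log (by positivity), Real.exp_neg,
        show 8 * (d * Real.log n) = ((8 * d : ℕ) : ℝ) * Real.log n by push_cast; ring,
        Real.exp_nat_mul, Real.exp_log hn0]
      field_simp
    rw [e, Real.exp_le_exp]
    linarith
  have h2 : (2 * n + 1 : ℝ) ^ d ≤ (n : ℝ) ^ (3 * d) := by
    rw [pow_mul]
    exact pow_le_pow_left₀ (by positivity)
      (by nlinarith [mul_le_mul hn2 hn2 (by norm_num) hn0.le]) d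
  have h3 : (4 : ℝ) ≤ (n : ℝ) ^ (5 * d) := by
    calc (4 : ℝ) ≤ (n : ℝ) ^ 2 := by nlinarith
      _ ≤ _ := pow_le_pow_right₀ (by linarith) (by omega)
  have h4 : (n : ℝ) ^ (8 * d) = (n : ℝ) ^ (5 * d) * (n : ℝ) ^ (3 * d) := by
    rw [← pow_add]; congr 1; ring
  calc 2 * (2 * (2 * n + 1) ^ d * Real.exp (-(8 * L)))
      = 4 * (2 * n + 1) ^ d * Real.exp (-(8 * L)) := by ring
    _ ≤ (n : ℝ) ^ (5 * d) * (n : ℝ) ^ (3 * d) * (δ / (n : ℝ) ^ (8 * d)) := by gcongr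
    _ = δ := by rw [← h4]; field_simp

theorem measure_exists_integral_gt_mean_add_le {Z : Type u} [MeasurableSpace Z] {P : Measure Z}
    [IsProbabilityMeasure P] {F : Set (Z → Bool)} (hF : vcDimension F ≠ ⊤)
    (hm : IsMeasurableClass (realClass F) P) {n : ℕ} (hn : 2 ≤ n) {δ L : ℝ} (hδ : 0 < δ)
    (hδ1 : δ < 1) (hL : (vcDimension F).toNat * Real.log n + Real.log (1 / δ) ≤ L) :
    (Measure.pi fun _ : Fin n => P)
        {z | ∃ f ∈ realClass F,
          8 * Real.sqrt (L / n) < ∫ x, f x ∂P - (1 / (n : ℝ)) * ∑ i, f (z i)}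
      ≤ ENNReal.ofReal δ := by
  rcases F.eq_empty_or_nonempty with rfl | hne
  · simp [realClass]
  have hn2 : (2 : ℝ) ≤ n := by exact_mod_cast hn
  have hn0 : (0 : ℝ) < n := by linarith
  have hl : 0 < Real.log (1 / δ) := Real.log_pos (by rw [lt_div_iff₀ hδ]; linarith)
  have hlogn : Real.log 2 ≤ Real.log n := Real.log_le_log (by norm_num) hn2
  have hlog2 : 0 < Real.log 2 := Real.log_pos (by norm_num)
  have hdl : 0 ≤ (vcDimension F).toNat * Real.log n := by
    have : 0 ≤ Real.log n := by linarith
    positivity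
  have hL0 : 0 < L := by linarith
  have hsq : n * Real.sqrt (L / n) ^ 2 = L := by
    rw [Real.sq_sqrt (by positivity)]; field_simp
  -- In dimension zero `L` may be close to `0` and cannot absorb the factor `4`; the class is then a
  -- single function and Hoeffding's inequality suffices.
  rcases Nat.eq_zero_or_pos (vcDimension F).toNat with h0 | hpos
  · obtain ⟨f₀, hf₀⟩ := hne
    have hmem : (fun z => if f₀ z = true then (1 : ℝ) else 0) ∈ realClass F := ⟨f₀, hf₀, rfl⟩
    have H := measure_integral_sub_mean_ge_le P (hm.1 _ hmem) (realClass_mem_Icc hmem)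
      (n := n) (by omega) (r := 8 * Real.sqrt (L / n)) (by positivity)
    refine (measure_mono ?_).trans (H.trans (ENNReal.ofReal_le_ofReal ?_))
    · rintro z ⟨_, ⟨f, hf, rfl⟩, hz⟩
      rw [eq_of_toNat_vcDimension_eq_zero hF h0 hf hf₀] at hz
      exact hz.le
    · rw [← Real.le_log_iff_exp_le hδ]
      rw [one_div, Real.log_inv] at hl hL
      nlinarith
  · have hd : (1 : ℝ) ≤ (vcDimension F).toNat := by exact_mod_cast hpos
    have hL2 : Real.log 2 ≤ L := by nlinarith
    have hnr : Real.exp (-(2 * n * (4 * Real.sqrt (L / n)) ^ 2)) ≤ 1 / 2 := by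
      rw [← Real.le_log_iff_exp_le (by norm_num), one_div, Real.log_inv]
      nlinarith
    -- With this `r`, the threshold `2 * r` is `8 * √(L / n)` and the exponent `n * r ^ 2 / 2` is `8
    -- * L`.
    have H := measure_exists_integral_sub_mean_gt_le hm (n := n) (by omega)
      (r := 4 * Real.sqrt (L / n)) (by positivity) hnr
    have H2 := measure_doubleSampleGap_gt_le hne hF hm n
      (r := 4 * Real.sqrt (L / n)) (by positivity)
    rw [show 2 * (4 * Real.sqrt (L / n)) = 8 * Real.sqrt (L / n) by ring] at H
    refine H.trans ((mul_le_mul_right H2 2).trans ?_)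
    rw [show n * (4 * Real.sqrt (L / n)) ^ 2 / 2 = 8 * L by nlinarith,
      show (2 : ENNReal) = ENNReal.ofReal 2 by simp, ← ENNReal.ofReal_mul (by norm_num)]
    exact ENNReal.ofReal_le_ofReal (four_mul_growth_mul_exp_le hn hpos hδ hδ1 hL)

/-! ### The deterministic comparison -/

theorem zeroOneLoss_nonneg (a b : Bool) : 0 ≤ zeroOneLoss a b := by
  unfold zeroOneLoss; split_ifs <;> simp

theorem zeroOneLoss_le_one (a b : Bool) : zeroOneLoss a b ≤ 1 := by
  unfold zeroOneLoss; split_ifs <;> simp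

theorem bddAbove_zeroOneLoss {X : Type u} (B : X → Set X) (h : X → Bool) (z : X × Bool) :
    BddAbove (Set.range fun x' : B z.1 => zeroOneLoss (h x') z.2) :=
  ⟨1, by rintro _ ⟨x, rfl⟩; exact zeroOneLoss_le_one _ _⟩

/-- The supremum that defines the adversarial loss is attained. -/
theorem exists_zeroOneLoss_eq_advZeroOneLoss {X : Type u} {B : X → Set X}
    (hB : ∀ x, (B x).Nonempty) (h : X → Bool) (z : X × Bool) :
    ∃ x' ∈ B z.1, zeroOneLoss (h x') z.2 = advZeroOneLoss B h z := by
  have : Nonempty (B z.1) := (hB z.1).to_subtype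
  have hfin : (Set.range fun x' : B z.1 => zeroOneLoss (h x') z.2).Finite := by
    refine (Set.toFinite {(0 : ℝ), 1}).subset ?_
    rintro _ ⟨x, rfl⟩
    unfold zeroOneLoss
    dsimp only
    split_ifs <;> simp
  obtain ⟨x, hx⟩ := (Set.range_nonempty _).csSup_mem hfin
  exact ⟨x, x.2, hx⟩

open Classical in
theorem advZeroOneLoss_eq_ite {X : Type u} {B : X → Set X}
    (hB : ∀ x, (B x).Nonempty) (h : X → Bool) (z : X × Bool) :
    advZeroOneLoss B h z = if ∃ x' ∈ B z.1, h x' ≠ z.2 then 1 else 0 := by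
  obtain ⟨x, hx, hxe⟩ := exists_zeroOneLoss_eq_advZeroOneLoss hB h z
  split_ifs with hex
  · obtain ⟨y, hy, hyne⟩ := hex
    have h1 : zeroOneLoss (h y) z.2 ≤ advZeroOneLoss B h z :=
      le_ciSup (bddAbove_zeroOneLoss B h z) ⟨y, hy⟩
    have h2 : zeroOneLoss (h y) z.2 = 1 := if_neg hyne
    linarith [zeroOneLoss_le_one (h x) z.2]
  · push Not at hex
    rw [← hxe, zeroOneLoss, if_pos (hex x hx)]

-- Links the real-valued class, used for risk and measurability, to the Boolean class, used for
-- shattering.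
open Classical in
theorem advLossClass_eq_realClass {X : Type u} {B : X → Set X} (hB : ∀ x, (B x).Nonempty)
    (H : Set (X → Bool)) :
    advLossClass B H = realClass
      {f : X × Bool → Bool | ∃ h ∈ H, ∀ z, f z = decide (∃ x' ∈ B z.1, h x' ≠ z.2)} := by
  ext f
  constructor
  · rintro ⟨h, hh, rfl⟩
    refine ⟨fun z => decide (∃ x' ∈ B z.1, h x' ≠ z.2), ⟨h, hh, fun _ => rfl⟩, funext fun z => ?_⟩
    simp only [advZeroOneLoss_eq_ite hB, decide_eq_true_eq]
  · rintro ⟨g, ⟨h, hh, hg⟩, rfl⟩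
    refine ⟨h, hh, funext fun z => ?_⟩
    simp only [advZeroOneLoss_eq_ite hB, hg, decide_eq_true_eq]

theorem empRisk_nonneg {X : Type u} {n : ℕ} (h : X → Bool) (Z : Fin n → X × Bool) :
    0 ≤ empRisk h Z :=
  mul_nonneg (by positivity) (Finset.sum_nonneg fun _ _ => zeroOneLoss_nonneg _ _)

theorem one_div_mul_sum_le_one {n : ℕ} {a : Fin n → ℝ} (ha : ∀ i, a i ≤ 1) :
    (1 / (n : ℝ)) * ∑ i, a i ≤ 1 := by
  have h : ∑ i, a i ≤ n := (Finset.sum_le_sum fun i _ => ha i).trans (by simp)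
  calc (1 / (n : ℝ)) * ∑ i, a i ≤ (1 / (n : ℝ)) * n := by gcongr
    _ ≤ 1 := by rw [one_div, mul_comm]; exact mul_inv_le_one

theorem empRisk_le_one {X : Type u} {n : ℕ} (h : X → Bool) (Z : Fin n → X × Bool) :
    empRisk h Z ≤ 1 :=
  one_div_mul_sum_le_one fun _ => zeroOneLoss_le_one _ _

theorem empFreq_mem_Icc {X : Type u} {n : ℕ} (g : X → Bool) (x : Fin n → X) :
    empFreq g x ∈ Set.Icc (0 : ℝ) 1 := by
  refine ⟨mul_nonneg (by positivity) (Finset.sum_nonneg fun _ _ => ?_),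
    one_div_mul_sum_le_one fun _ => ?_⟩ <;> split_ifs <;> simp

theorem abs_empFreq_sub_le_one {X : Type u} {n : ℕ} (g : X → Bool) (x y : Fin n → X) :
    |empFreq g x - empFreq g y| ≤ 1 := by
  have h1 := empFreq_mem_Icc g x
  have h2 := empFreq_mem_Icc g y
  exact abs_le.2 ⟨by linarith [h1.1, h2.2], by linarith [h1.2, h2.1]⟩

theorem bddAbove_abs_empFreq_sub {X : Type u} {n : ℕ} (H : Set (X → Bool)) (x y : Fin n → X) :
    BddAbove (Set.range fun g : symmDiffClass H => |empFreq g.1 x - empFreq g.1 y|) :=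
  ⟨1, by rintro _ ⟨g, rfl⟩; exact abs_empFreq_sub_le_one _ _ _⟩

theorem empDivergence_nonneg {X : Type u} {n : ℕ} (H : Set (X → Bool)) (x y : Fin n → X) :
    0 ≤ empDivergence H x y :=
  mul_nonneg zero_le_two (Real.iSup_nonneg fun _ => abs_nonneg _)

theorem empDivergence_le_two {X : Type u} {n : ℕ} (H : Set (X → Bool)) (x y : Fin n → X) :
    empDivergence H x y ≤ 2 := by
  have := Real.iSup_le (fun g : symmDiffClass H => abs_empFreq_sub_le_one g.1 x y) zero_le_one
  unfold empDivergence
  linarith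

theorem bddBelow_joint {X : Type u} {n : ℕ} (H : Set (X → Bool)) (ZS ZT : Fin n → X × Bool) :
    BddBelow (Set.range fun h : H => empRisk h.1 ZS + empRisk h.1 ZT) :=
  ⟨0, by rintro _ ⟨h, rfl⟩; exact add_nonneg (empRisk_nonneg _ _) (empRisk_nonneg _ _)⟩

theorem empJointLoss_nonneg {X : Type u} {n : ℕ} (H : Set (X → Bool))
    (ZS ZT : Fin n → X × Bool) : 0 ≤ empJointLoss H ZS ZT :=
  Real.iInf_nonneg fun _ => add_nonneg (empRisk_nonneg _ _) (empRisk_nonneg _ _)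

theorem empJointLoss_le_two {X : Type u} {n : ℕ} {H : Set (X → Bool)} {h : X → Bool} (hh : h ∈ H)
    (ZS ZT : Fin n → X × Bool) : empJointLoss H ZS ZT ≤ 2 :=
  (ciInf_le (bddBelow_joint H ZS ZT) ⟨h, hh⟩).trans
    (by linarith [empRisk_le_one h ZS, empRisk_le_one h ZT])

theorem empRisk_le_empFreq_add {X : Type u} {n : ℕ} (h k : X → Bool) (Z : Fin n → X × Bool) :
    empRisk h Z ≤ empFreq (fun x => xor (h x) (k x)) (fun i => (Z i).1) + empRisk k Z := by
  unfold empRisk empFreq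
  rw [← mul_add, ← Finset.sum_add_distrib]
  refine mul_le_mul_of_nonneg_left (Finset.sum_le_sum fun i _ => ?_) (by positivity)
  unfold zeroOneLoss
  cases eh : h (Z i).1 <;> cases ek : k (Z i).1 <;> cases (Z i).2 <;> simp [eh, ek]

theorem empFreq_le_empRisk_add {X : Type u} {n : ℕ} (h k : X → Bool) (Z : Fin n → X × Bool) :
    empFreq (fun x => xor (h x) (k x)) (fun i => (Z i).1) ≤ empRisk h Z + empRisk k Z := by
  unfold empRisk empFreq
  rw [← mul_add, ← Finset.sum_add_distrib]
  refine mul_le_mul_of_nonneg_left (Finset.sum_le_sum fun i _ => ?_) (by positivity)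
  unfold zeroOneLoss
  cases eh : h (Z i).1 <;> cases ek : k (Z i).1 <;> cases (Z i).2 <;> simp [eh, ek]

/-- The empirical domain adaptation inequality. -/
theorem empRisk_le_add_empDivergence_add_empJointLoss {X : Type u} {n : ℕ} {H : Set (X → Bool)}
    {h : X → Bool} (hh : h ∈ H) (ZS ZT : Fin n → X × Bool) :
    empRisk h ZT ≤ empRisk h ZS
      + (empDivergence H (fun i => (ZS i).1) (fun i => (ZT i).1) + 2 * empJointLoss H ZS ZT) := by
  have : Nonempty H := ⟨⟨h, hh⟩⟩
  set xS := fun i => (ZS i).1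
  set xT := fun i => (ZT i).1
  -- The triangle inequality through `k` costs only half the divergence and one joint loss;
  -- nonnegativity gives the weaker stated form.
  have key : empRisk h ZT - empRisk h ZS - empDivergence H xS xT / 2 ≤ empJointLoss H ZS ZT := by
    refine le_ciInf fun k => ?_
    have h1 := empRisk_le_empFreq_add h k.1 ZT
    have h2 := empFreq_le_empRisk_add h k.1 ZS
    have h3 := le_ciSup (bddAbove_abs_empFreq_sub H xS xT)
      ⟨fun x => xor (h x) (k.1 x), h, hh, k.1, k.2, rfl⟩
    have h4 := (abs_le.1 h3).1
    have h5 : empDivergence H xS xT / 2 =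
        ⨆ g : symmDiffClass H, |empFreq g.1 xS - empFreq g.1 xT| := by
      unfold empDivergence; ring
    dsimp only at h4
    linarith
  linarith [empDivergence_nonneg H xS xT, empJointLoss_nonneg H ZS ZT]

theorem mean_advZeroOneLoss_le {X : Type u} {n : ℕ} {B : X → Set X} (hB : ∀ x, (B x).Nonempty)
    {H : Set (X → Bool)} {h : X → Bool} (hh : h ∈ H) (ZS ZT : Fin n → X × Bool) :
    (1 / (n : ℝ)) * ∑ i, advZeroOneLoss B h (ZT i)
      ≤ empRisk h ZS + worstCaseTarget B H ZS ZT := by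
  choose x' hx' hxe using fun i => exists_zeroOneLoss_eq_advZeroOneLoss hB h (ZT i)
  -- A real supremum dominates its terms only if bounded; here `6 = 2 + 2 * 2`.
  have hbdd : BddAbove (Set.range fun x' : {x' : Fin n → X // ∀ i, x' i ∈ B (ZT i).1} =>
      (empDivergence H (fun i => (ZS i).1) x'.1
        + 2 * empJointLoss H ZS (fun i => (x'.1 i, (ZT i).2)))) := by
    refine ⟨6, ?_⟩
    rintro _ ⟨y, rfl⟩
    have h1 := empDivergence_le_two H (fun i => (ZS i).1) y.1
    have h2 := empJointLoss_le_two hh ZS (fun i => (y.1 i, (ZT i).2))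
    dsimp only
    linarith
  have h1 := empRisk_le_add_empDivergence_add_empJointLoss hh ZS (fun i => (x' i, (ZT i).2))
  have h2 := le_ciSup hbdd ⟨x', hx'⟩
  have h3 : (1 / (n : ℝ)) * ∑ i, advZeroOneLoss B h (ZT i)
      = empRisk h (fun i => (x' i, (ZT i).2)) := by
    simp only [empRisk, hxe]
  rw [h3]
  exact h1.trans (add_le_add_right h2 _)

/-! ### Assembly of the deterministic and probabilistic bounds -/

theorem theorem2 :
    ∃ C : ℝ, 0 < C ∧
      ∀ (X : Type u) [MeasurableSpace X] (B : X → Set X) (H : Set (X → Bool))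
        (DS DT : Measure (X × Bool)) [IsProbabilityMeasure DS] [IsProbabilityMeasure DT],
        (∀ x, (B x).Nonempty) →
        vcDimension H ≠ ⊤ →
        advVCDimension B H ≠ ⊤ →
        IsMeasurableClass (advLossClass B H) DT →
        ∀ (n : ℕ), 2 ≤ n → ∀ δ : ℝ, 0 < δ → δ < 1 →
          ((Measure.pi fun _ : Fin n => DS).prod (Measure.pi fun _ : Fin n => DT))
            {Z | ¬ ∀ h ∈ H,
              advRisk B h DT ≤ empRisk h Z.1 + worstCaseTarget B H Z.1 Z.2
                + C * Real.sqrt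
                    ((max ((vcDimension H).toNat : ℝ) ((advVCDimension B H).toNat : ℝ)
                        * Real.log n + Real.log (1 / δ)) / n)}
            ≤ ENNReal.ofReal δ := by
  classical
  refine ⟨8, by norm_num, ?_⟩
  intro X _ B H DS DT _ _ hB _ hA hm n hn δ hδ hδ1
  rw [advLossClass_eq_realClass hB] at hm
  have hn1 : (1 : ℝ) ≤ n := by exact_mod_cast (by omega : 1 ≤ n)
  set L : ℝ := max ((vcDimension H).toNat : ℝ) ((advVCDimension B H).toNat : ℝ) * Real.log n
    + Real.log (1 / δ) with hLdef
  have hL : ((advVCDimension B H).toNat : ℝ) * Real.log n + Real.log (1 / δ) ≤ L := by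
    have := mul_le_mul_of_nonneg_right
      (le_max_right ((vcDimension H).toNat : ℝ) ((advVCDimension B H).toNat : ℝ))
      (Real.log_nonneg hn1)
    linarith
  have hdev := measure_exists_integral_gt_mean_add_le hA hm hn hδ hδ1 hL
  rw [← advLossClass_eq_realClass hB] at hdev
  -- The comparison holds for every source sample, so failure forces a target-only event.
  -- Monotonicity of outer measure needs no measurability of the failure event.
  refine (measure_mono (t := Set.univ ×ˢ {z : Fin n → X × Bool | ∃ f ∈ advLossClass B H,
    8 * Real.sqrt (L / n) < ∫ x, f x ∂DT - (1 / (n : ℝ)) * ∑ i, f (z i)}) ?_).trans ?_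
  · intro Z hZ
    simp only [Set.mem_ofPred_eq, not_forall, not_le] at hZ
    obtain ⟨h, hh, hlt⟩ := hZ
    refine ⟨Set.mem_univ _, advZeroOneLoss B h, ⟨h, hh, rfl⟩, ?_⟩
    have h1 := mean_advZeroOneLoss_le hB hh Z.1 Z.2
    unfold advRisk at hlt
    linarith
  · rw [Measure.prod_prod, measure_univ, one_mul]
    exact hdev
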